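/- Let $\mathbb{H}[t]$ be the ring of polynomials over the real quaternions in a central indeterminate $t$, and $\mathbb{DH}[t]=\mathbb{H}[t]+\varepsilon\mathbb{H}[t]$ with $\varepsilon$ central, $\varepsilon^2=0$. For $C=P+\varepsilon D$ put $\overline{C}=\overline{P}+\varepsilon\overline{D}$ and $C_\varepsilon=P-\varepsilon D$; $C$ is a motion polynomial if $P\overline{D}+D\overline{P}=0$ and $P\ne 0$. The degree is the degree in $t$. Let $L=L_p+\varepsilon L_d\in\mathbb{DH}[t]$ be a line polynomial, i.e. $L_p,L_d$ have zero scalar part, $L_p\overline{L_d}+L_d\overline{L_p}=0$ and $L_p\neq0$. Let $L$ be kinematic ($L_p\overline{L_p}$ is a square in $\mathbb{R}[t]$) and saturated (the monic $\ell\in\mathbb{R}[t]$ of least degree such that $\ell L_p=P\mathbf{k}\overline{P}$ for some $P\in\mathbb{H}[t]$ is $\ell=1$). Let $h\in\mathbb{R}[t]$ be a greatest common divisor of the coordinates of $L_p$. **(a)** There is $Q\in\mathbb{H}[t]$ with $Q\mathbf{k}\overline{Q}=L_p/h$. For every such $Q$ there is a motion polynomial $C=P+\varepsilon D$ with $P=Qh$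 and $C_\varepsilon\,\mathbf{k}\,\overline{C_\varepsilon}=hL$; if $\deg L_d\le\deg L_p$, then $C$ can be chosen such that moreover $\deg C=\tfrac12(\deg L+\deg h)$. **(b)** The dual part is given by explicit formulas, after a rotation of the fixed frame. For $Q$ as in (a) and a quaternion $r$ with $r\overline{r}=1$, put $$rQ=q_0+q_1\mathbf{i}+q_2\mathbf{j}+q_3\mathbf{k},\qquad (rQ)\mathbf{k}\overline{(rQ)}=m_1\mathbf{i}+m_2\mathbf{j}+m_3\mathbf{k},\qquad L'=rL\overline{r},\qquad rL_d\overline{r}=k_5\mathbf{i}+k_6\mathbf{j}+k_7\mathbf{k}.$$ There is such an $r$ with $$q_3\ne0,\qquad m_3\neq0,\qquad \gcd(q_0,q_3)=1 \tag{G}$$ and $\deg q_1\le\deg q_3$, $\deg q_2\le\deg q_3$. For every $r$ satisfying (G) and all $a,b\in\mathbb{R}[t]$ with $aq_0+bq_3=1$, put $d_0=-\tfrac14k_7a$. Then $$d_1=-\frac{d_0q_2}{q_3}+\frac{k_5(q_2^2-q_3^2)+k_6(q_0q_3-q_1q_2)}{2q_3m_3},\qquad d_2=\frac{d_0q_1}{q_3}+\frac{k_5(-q_0q_3-q_1q_2)+k_6(q_1^2-q_3^2)}{2q_3m_3},$$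 $$d_3=-\frac{d_0q_0}{q_3}+\frac{k_5(q_1q_3+q_0q_2)+k_6(q_2q_3-q_0q_1)}{2q_3m_3}$$ are polynomials. Write $d_0=\lambda q_3+\varrho$ with $\lambda,\varrho\in\mathbb{R}[t]$, $\deg\varrho<\deg q_3$. Then $$C'=h\,rQ+\varepsilon\bigl(d_0+d_1\mathbf{i}+d_2\mathbf{j}+d_3\mathbf{k}+\lambda\, rQ\,\mathbf{k}\bigr)$$ is a motion polynomial with $C'_\varepsilon\mathbf{k}\overline{C'_\varepsilon}=hL'$, and $C=\overline{r}\,C'$ is a motion polynomial with primal part $Qh$ and $C_\varepsilon\mathbf{k}\overline{C_\varepsilon}=hL$. If $\deg L_d\le\deg L_p$, $\deg q_1\le\deg q_3$ and $\deg q_2\le\deg q_3$, then moreover $\deg C=\tfrac12(\deg L+\deg h)$. -/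

import Mathlib

open Polynomial
open scoped Quaternion

noncomputable section

/-- Quaternionic polynomials `ℍ[t]`, written through their four real polynomial coordinates:
`P = p₀ + p₁ i + p₂ j + p₃ k` with `p₀, …, p₃ ∈ ℝ[t]`. The indeterminate is central. -/
abbrev QPoly : Type := ℍ[ℝ[X]]

/-- Dual quaternionic polynomials `𝔻ℍ[t] = ℍ[t] + ε ℍ[t]`, where `ε² = 0` and `ε` is central. -/
abbrev DQPoly : Type := DualNumber QPoly

/-- The dual quaternionic polynomial `P + ε D`. -/
def mkDual (P D : QPoly) : DQPoly := TrivSqZeroExt.inl P + TrivSqZeroExt.inr D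

/-- The primal part `P` of `C = P + ε D`. -/
def primal (C : DQPoly) : QPoly := TrivSqZeroExt.fst C

/-- The dual part `D` of `C = P + ε D`. -/
def dual (C : DQPoly) : QPoly := TrivSqZeroExt.snd C

/-- Conjugation `P + ε D ↦ P̄ + ε D̄`. -/
def conj (C : DQPoly) : DQPoly := mkDual (star (primal C)) (star (dual C))

/-- The `ε`-conjugation `P + ε D ↦ P - ε D`. -/
def epsConj (C : DQPoly) : DQPoly := mkDual (primal C) (-dual C)

/-- The quaternion unit `k` as a constant polynomial. -/
def kQ : QPoly := ⟨0, 0, 0, 1⟩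

/-- The quaternion unit `k` as a constant dual quaternionic polynomial. -/
def kD : DQPoly := mkDual kQ 0

/-- A real quaternion as a constant polynomial. -/
def constQ (r : ℍ[ℝ]) : QPoly := ⟨C r.re, C r.imI, C r.imJ, C r.imK⟩

/-- A real quaternion as a constant dual quaternionic polynomial. -/
def constD (r : ℍ[ℝ]) : DQPoly := mkDual (constQ r) 0

/-- The degree in `t` of a quaternionic polynomial (the zero polynomial has degree `0`). -/
def qDeg (P : QPoly) : ℕ :=
  max (max P.re.natDegree P.imI.natDegree) (max P.imJ.natDegree P.imK.natDegree)

/-- The degree in `t` of a dual quaternionic polynomial. -/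
def dqDeg (C : DQPoly) : ℕ := max (qDeg (primal C)) (qDeg (dual C))

/-- `C = P + ε D` is a motion polynomial: its norm polynomial `C C̄` is real and non-zero, i.e. the
Study condition `P D̄ + D P̄ = 0` holds and `P ≠ 0`. -/
def IsMotionPolynomial (C : DQPoly) : Prop :=
  primal C * star (dual C) + dual C * star (primal C) = 0 ∧ primal C ≠ 0

/-- `L = L_p + ε L_d` is a line polynomial: it is vectorial, it satisfies the Plücker condition,
and `L_p ≠ 0`. -/
def IsLinePolynomial (L : DQPoly) : Prop :=
  (primal L).re = 0 ∧ (dual L).re = 0 ∧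
    primal L * star (dual L) + dual L * star (primal L) = 0 ∧ primal L ≠ 0

/-- `L` is kinematic: the norm `L_p L̄_p` is the square of a real polynomial. -/
def IsKinematic (L : DQPoly) : Prop :=
  ∃ n : ℝ[X], primal L * star (primal L) = ((n ^ 2 : ℝ[X]) : QPoly)

/-- `ℓ` is a monic real polynomial such that `L_p ℓ = P k P̄` for some `P ∈ ℍ[t]`. -/
def IsSaturatingFactor (Lp : QPoly) (l : ℝ[X]) : Prop :=
  l.Monic ∧ ∃ P : QPoly, l • Lp = P * kQ * star P

/-- `ℓ` is a minimal saturating factor of `L_p`: a saturating factor of minimal degree. -/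
def IsMinimalSaturatingFactor (Lp : QPoly) (l : ℝ[X]) : Prop :=
  IsSaturatingFactor Lp l ∧ ∀ m : ℝ[X], IsSaturatingFactor Lp m → l.natDegree ≤ m.natDegree

/-- `L` is saturated: the minimal saturating factor of its primal part is `1`. -/
def IsSaturated (L : DQPoly) : Prop := IsMinimalSaturatingFactor (primal L) 1

/-- `h` is a greatest common real polynomial divisor of the quaternionic polynomial `P`. -/
def IsRgcd (P : QPoly) (h : ℝ[X]) : Prop :=
  ∀ g : ℝ[X], g ∣ h ↔ g ∣ P.re ∧ g ∣ P.imI ∧ g ∣ P.imJ ∧ g ∣ P.imK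

/-- The motion polynomial `C` moves the line `k` along `L`, up to the real factor `h`:
`C_ε k conj(C_ε) = h L`. -/
def IsSolution (h : ℝ[X]) (L C : DQPoly) : Prop :=
  IsMotionPolynomial C ∧ epsConj C * kD * conj (epsConj C) = h • L

/-- The genericity assumptions on `Q` (for `M = Q k Q̄`): `q₃ ≠ 0`, `m₃ ≠ 0`, `gcd(q₀, q₃) = 1`. -/
def IsGeneric (Q : QPoly) : Prop :=
  Q.imK ≠ 0 ∧ (Q * kQ * star Q).imK ≠ 0 ∧ IsCoprime Q.re Q.imK

/-- The formulas expressing `d₁, d₂, d₃` through `d₀`, for `Q = q₀ + q₁ i + q₂ j + q₃ k`,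
`M = Q k Q̄` and `L_d = k₅ i + k₆ j + k₇ k`; the common denominator `2 q₃ m₃` is cleared, so that
they determine the polynomials `d₁, d₂, d₃` uniquely if `q₃ ≠ 0` and `m₃ ≠ 0`. -/
def DualPartFormulas (Q Ld D : QPoly) : Prop :=
  2 * Q.imK * (Q * kQ * star Q).imK * D.imI =
    -(2 * D.re * Q.imJ * (Q * kQ * star Q).imK) +
      (Ld.imI * (Q.imJ ^ 2 - Q.imK ^ 2) + Ld.imJ * (Q.re * Q.imK - Q.imI * Q.imJ)) ∧
  2 * Q.imK * (Q * kQ * star Q).imK * D.imJ =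
    2 * D.re * Q.imI * (Q * kQ * star Q).imK +
      (Ld.imI * (-(Q.re * Q.imK) - Q.imI * Q.imJ) + Ld.imJ * (Q.imI ^ 2 - Q.imK ^ 2)) ∧
  2 * Q.imK * (Q * kQ * star Q).imK * D.imK =
    -(2 * D.re * Q.re * (Q * kQ * star Q).imK) +
      (Ld.imI * (Q.imI * Q.imK + Q.re * Q.imJ) + Ld.imJ * (Q.imJ * Q.imK - Q.re * Q.imI))

end

/-! Everything is governed by the vector `M = Q k Q̄`. Attach to `Q` the complex polynomials `z = q₀
+ i q₃` and `w = q₁ - i q₂`. Right multiplication by `c₀ + c₃ k` multiplies both by `c₀ + i c₃` and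
scales `M` by `c₀² + c₃²`. Saturation gives `L_p = P k P̄`. Splitting off `gcd(z, w)` on the right
leaves a `Q` whose `M` is primitive (`isUnit_of_dvd_conj_kQ`), so the real factor that came out is
`h` up to a constant.

With primal part `h Q`, the factor `h` cancels from the equations for the dual part, leaving a
linear system for `D` (`SolvesDual`). For `D = X Q` with `X` a vector it reads `2 M × X = L_d`. This
is solvable over `ℝ[t]` because `M · L_d = 0` (Plücker) and `M` is primitive (`exists_solvesDual`).
Adding multiples of `Q k` changes `d₀` by multiples of `q₃`, which allows the prescribed `d₀` when
`gcd(q₀, q₃) = 1`. The rational formulas then follow from the system, and their values are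
polynomials because a polynomial solution already exists.

A generic frame is found by turning the leading coefficient of `Q` into a multiple of `k + u j - v
i`. All but finitely many `u` make `q₀, q₃` coprime (`exists_isCoprime_rotation`). Once `d₀` is
reduced modulo `q₃`, the Plücker relation bounds `d₃`, and a system with determinant `q₀² + q₃²`
bounds `d₁, d₂` (`SolvesDual.qDeg_le`). -/

noncomputable section

/-! ### Primal and dual parts, constants -/

@[simp] lemma primal_mkDual (P D : QPoly) : primal (mkDual P D) = P := by simp [primal, mkDual]
@[simp] lemma dual_mkDual (P D : QPoly) : dual (mkDual P D) = D := by simp [dual, mkDual]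
@[simp] lemma primal_mul (A B : DQPoly) : primal (A * B) = primal A * primal B := by simp [primal]
@[simp] lemma dual_mul (A B : DQPoly) :
    dual (A * B) = primal A * dual B + dual A * primal B := by simp [primal, dual]
@[simp] lemma primal_smul (h : ℝ[X]) (A : DQPoly) : primal (h • A) = h • primal A := by
  simp [primal]
@[simp] lemma dual_smul (h : ℝ[X]) (A : DQPoly) : dual (h • A) = h • dual A := by simp [dual]
@[simp] lemma primal_conj (A : DQPoly) : primal (conj A) = star (primal A) := by simp [conj]
@[simp] lemma dual_conj (A : DQPoly) : dual (conj A) = star (dual A) := by simp [conj]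
@[simp] lemma primal_epsConj (A : DQPoly) : primal (epsConj A) = primal A := by simp [epsConj]
@[simp] lemma dual_epsConj (A : DQPoly) : dual (epsConj A) = -dual A := by simp [epsConj]
@[simp] lemma primal_kD : primal kD = kQ := by simp [kD]
@[simp] lemma dual_kD : dual kD = 0 := by simp [kD]
@[simp] lemma primal_constD (r : ℍ[ℝ]) : primal (constD r) = constQ r := by simp [constD]
@[simp] lemma dual_constD (r : ℍ[ℝ]) : dual (constD r) = 0 := by simp [constD]

lemma dqPoly_ext {A B : DQPoly} (hp : primal A = primal B) (hd : dual A = dual B) : A = B :=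
  TrivSqZeroExt.ext hp hd

lemma mkDual_primal_dual (A : DQPoly) : mkDual (primal A) (dual A) = A :=
  dqPoly_ext (by simp) (by simp)

@[simp] lemma kQ_re : kQ.re = 0 := rfl
@[simp] lemma kQ_imI : kQ.imI = 0 := rfl
@[simp] lemma kQ_imJ : kQ.imJ = 0 := rfl
@[simp] lemma kQ_imK : kQ.imK = 1 := rfl
@[simp] lemma constQ_re (r : ℍ[ℝ]) : (constQ r).re = C r.re := rfl
@[simp] lemma constQ_imI (r : ℍ[ℝ]) : (constQ r).imI = C r.imI := rfl
@[simp] lemma constQ_imJ (r : ℍ[ℝ]) : (constQ r).imJ = C r.imJ := rfl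
@[simp] lemma constQ_imK (r : ℍ[ℝ]) : (constQ r).imK = C r.imK := rfl

lemma constQ_star (r : ℍ[ℝ]) : constQ (star r) = star (constQ r) := by
  ext1 <;> simp

lemma constQ_mul (r s : ℍ[ℝ]) : constQ (r * s) = constQ r * constQ s := by
  ext1 <;> simp

lemma constQ_one : constQ 1 = 1 := by
  ext1 <;> simp

lemma constQ_mul_star {r : ℍ[ℝ]} (hr : r * star r = 1) : constQ r * star (constQ r) = 1 := by
  rw [← constQ_star, ← constQ_mul, hr, constQ_one]

lemma star_mul_constQ {r : ℍ[ℝ]} (hr : r * star r = 1) : star (constQ r) * constQ r = 1 := by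
  rw [← constQ_star, ← constQ_mul, Quaternion.star_mul_self, ← Quaternion.self_mul_star, hr,
    constQ_one]

lemma conj_polar_neg {R : Type*} [CommRing R] (P D k : ℍ[R]) :
    P * k * star (-D) + -D * k * star P = -(D * k * star P + P * k * star D) := by
  rw [star_neg]
  noncomm_ring

/-- The defining equations of a solution, in terms of primal and dual part. -/
lemma isSolution_iff {h : ℝ[X]} {L A : DQPoly} : IsSolution h L A ↔
    (primal A * star (dual A) + dual A * star (primal A) = 0 ∧ primal A ≠ 0) ∧
      primal A * kQ * star (primal A) = h • primal L ∧
      -(dual A * kQ * star (primal A) + primal A * kQ * star (dual A)) = h • dual L := by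
  unfold IsSolution IsMotionPolynomial
  have e1 : primal (epsConj A * kD * conj (epsConj A)) = primal A * kQ * star (primal A) := by
    simp
  have e2 : dual (epsConj A * kD * conj (epsConj A)) =
      -(dual A * kQ * star (primal A) + primal A * kQ * star (dual A)) := by
    rw [← conj_polar_neg]
    simp only [dual_mul, primal_mul, dual_conj, primal_conj, dual_epsConj, primal_epsConj,
      primal_kD, dual_kD, mul_zero, zero_add]
  refine and_congr_right fun _ => ⟨fun H => ?_, fun H => dqPoly_ext ?_ ?_⟩
  · rw [← e1, ← e2, H]
    simp
  · rw [e1, H.1, primal_smul]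
  · rw [e2, H.2, dual_smul]

/-! ### Rotation of the fixed frame -/

section Rotation

variable {R : Type*} [CommRing R] {s : ℍ[R]}

lemma rotate_back (e : star s * s = 1) (h : R) (X : ℍ[R]) :
    star s * (h • (s * X * star s)) * s = h • X := by
  rw [mul_smul_comm, smul_mul_assoc]
  congr 1
  calc star s * (s * X * star s) * s = (star s * s) * X * (star s * s) := by noncomm_ring
    _ = X := by rw [e]; simp

lemma rotate_conj (X Y Z : ℍ[R]) :
    star s * X * Y * star (star s * Z) = star s * (X * Y * star Z) * s := by
  simp [mul_assoc]

lemma rotate_conj_one (X Z : ℍ[R]) :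
    star s * X * star (star s * Z) = star s * (X * star Z) * s := by
  simp [mul_assoc]

lemma rotate_add (X Y : ℍ[R]) :
    star s * X * s + star s * Y * s = star s * (X + Y) * s := by
  noncomm_ring

lemma rotate_neg (X : ℍ[R]) : -(star s * X * s) = star s * (-X) * s := by
  noncomm_ring

lemma rotate_ne_zero (e : s * star s = 1) {X : ℍ[R]} (hX : X ≠ 0) : star s * X ≠ 0 := by
  intro h0
  apply hX
  rw [← one_mul X, ← e, mul_assoc, h0, mul_zero]

end Rotation

/-- Rotating the fixed frame maps solutions to solutions. -/
lemma IsSolution.rotate {h : ℝ[X]} {L A : DQPoly} {r : ℍ[ℝ]} (hr : r * star r = 1)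
    (hA : IsSolution h (constD r * L * constD (star r)) A) :
    IsSolution h L (constD (star r) * A) := by
  rw [isSolution_iff] at hA ⊢
  obtain ⟨⟨h1, h2⟩, h3, h4⟩ := hA
  have e1 := constQ_mul_star hr
  have e2 := star_mul_constQ hr
  simp only [primal_mul, dual_mul, primal_constD, dual_constD, constQ_star, zero_mul, zero_add,
    add_zero, mul_zero] at h1 h2 h3 h4 ⊢
  generalize constQ r = s at *
  refine ⟨⟨?_, rotate_ne_zero e1 h2⟩, ?_, ?_⟩
  · rw [rotate_conj_one, rotate_conj_one, rotate_add, h1, mul_zero, zero_mul]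
  · rw [rotate_conj, h3, rotate_back e2]
  · rw [rotate_conj, rotate_conj, rotate_add, rotate_neg, h4, rotate_back e2]

/-! ### Degree and norm of quaternionic polynomials -/

/-- The top coefficient is a sum of squares of real numbers, so nothing cancels. Degree questions
thereby reduce to the multiplicative `normSq`. -/
lemma natDegree_normSq (P : QPoly) : (Quaternion.normSq P).natDegree = 2 * qDeg P := by
  have h0 : P.re.natDegree ≤ qDeg P := by simp [qDeg]
  have h1 : P.imI.natDegree ≤ qDeg P := by simp [qDeg]
  have h2 : P.imJ.natDegree ≤ qDeg P := by simp [qDeg]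
  have h3 : P.imK.natDegree ≤ qDeg P := by simp [qDeg]
  have hc : (Quaternion.normSq P).coeff (2 * qDeg P) = P.re.coeff (qDeg P) ^ 2 +
      P.imI.coeff (qDeg P) ^ 2 + P.imJ.coeff (qDeg P) ^ 2 + P.imK.coeff (qDeg P) ^ 2 := by
    rw [Quaternion.normSq_def', two_mul]
    simp only [coeff_add, pow_two]
    rw [coeff_mul_add_eq_of_natDegree_le h0 h0, coeff_mul_add_eq_of_natDegree_le h1 h1,
      coeff_mul_add_eq_of_natDegree_le h2 h2, coeff_mul_add_eq_of_natDegree_le h3 h3]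
  have hle : (Quaternion.normSq P).natDegree ≤ 2 * qDeg P := by
    rw [Quaternion.normSq_def']
    refine natDegree_add_le_of_degree_le (natDegree_add_le_of_degree_le
      (natDegree_add_le_of_degree_le ?_ ?_) ?_) ?_ <;>
    exact natDegree_pow_le_of_le 2 (by assumption)
  refine le_antisymm hle ?_
  -- Positivity of the degree ensures that a coordinate attaining it is non-zero; in degree zero the
  -- bound is trivial.
  rcases Nat.eq_zero_or_pos (qDeg P) with hn | hn
  · simp [hn]
  apply le_natDegree_of_ne_zero
  rw [hc]
  have lead : ∀ p : ℝ[X], p.natDegree = qDeg P → 0 < p.coeff (qDeg P) ^ 2 := by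
    intro p hp
    rw [← hp]
    have : p ≠ 0 := by
      rintro rfl
      simp at hp
      omega
    have := leadingCoeff_ne_zero.mpr this
    unfold leadingCoeff at this
    positivity
  have hcases : P.re.natDegree = qDeg P ∨ P.imI.natDegree = qDeg P ∨ P.imJ.natDegree = qDeg P ∨
      P.imK.natDegree = qDeg P := by
    unfold qDeg
    omega
  apply ne_of_gt
  rcases hcases with h | h | h | h <;> have := lead _ h <;> positivity

lemma natDegree_sq_add_sq {p q : ℝ[X]} :
    (p ^ 2 + q ^ 2).natDegree = 2 * max p.natDegree q.natDegree := by
  obtain ⟨P, rfl, rfl, h2, h3⟩ : ∃ P : QPoly, P.re = p ∧ P.imI = q ∧ P.imJ = 0 ∧ P.imK = 0 :=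
    ⟨⟨p, q, 0, 0⟩, rfl, rfl, rfl, rfl⟩
  have := natDegree_normSq P
  rw [Quaternion.normSq_def', qDeg, h2, h3] at this
  simpa using this

lemma normSq_ne_zero_of_ne_zero {P : QPoly} (hP : P ≠ 0) : Quaternion.normSq P ≠ 0 := by
  intro h
  apply hP
  rw [Quaternion.normSq_def'] at h
  have hs : ∀ x : ℝ, P.re.eval x = 0 ∧ P.imI.eval x = 0 ∧ P.imJ.eval x = 0 ∧ P.imK.eval x = 0 := by
    intro x
    have hx := congrArg (eval x) h
    simp only [eval_add, eval_pow, eval_zero] at hx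
    refine ⟨?_, ?_, ?_, ?_⟩ <;> nlinarith [sq_nonneg (P.re.eval x), sq_nonneg (P.imI.eval x),
      sq_nonneg (P.imJ.eval x), sq_nonneg (P.imK.eval x)]
  ext1 <;> refine Polynomial.funext fun x => ?_
  · simpa using (hs x).1
  · simpa using (hs x).2.1
  · simpa using (hs x).2.2.1
  · simpa using (hs x).2.2.2

lemma qDeg_mul {P Q : QPoly} (hP : P ≠ 0) (hQ : Q ≠ 0) : qDeg (P * Q) = qDeg P + qDeg Q := by
  have := natDegree_normSq (P * Q)
  rw [map_mul, natDegree_mul (normSq_ne_zero_of_ne_zero hP) (normSq_ne_zero_of_ne_zero hQ),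
    natDegree_normSq, natDegree_normSq] at this
  omega

lemma qDeg_star (P : QPoly) : qDeg (star P) = qDeg P := by simp [qDeg]

lemma qDeg_constQ (r : ℍ[ℝ]) : qDeg (constQ r) = 0 := by simp [qDeg]

lemma qDeg_kQ : qDeg kQ = 0 := by simp [qDeg]

lemma kQ_ne_zero : kQ ≠ 0 := fun h => by simpa using congrArg QuaternionAlgebra.imK h

lemma qDeg_smul {h : ℝ[X]} {P : QPoly} (hh : h ≠ 0) (hP : P ≠ 0) :
    qDeg (h • P) = h.natDegree + qDeg P := by
  have := natDegree_normSq (h • P)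
  rw [Quaternion.normSq_smul, natDegree_mul (pow_ne_zero 2 hh) (normSq_ne_zero_of_ne_zero hP),
    natDegree_normSq, natDegree_pow] at this
  omega

lemma qDeg_constQ_mul {r : ℍ[ℝ]} (hr : constQ r ≠ 0) (P : QPoly) :
    qDeg (constQ r * P) = qDeg P := by
  rcases eq_or_ne P 0 with rfl | hP
  · rw [mul_zero]
  · rw [qDeg_mul hr hP, qDeg_constQ, zero_add]

lemma star_ne_zero_of_ne_zero {P : QPoly} (hP : P ≠ 0) : star P ≠ 0 := fun h => hP (by
  rw [← star_star P, h]; ext1 <;> simp)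

lemma qDeg_conj_kQ {Q : QPoly} (hQ : Q ≠ 0) : qDeg (Q * kQ * star Q) = 2 * qDeg Q := by
  have h1 : Q * kQ ≠ 0 := fun h => by
    have := congrArg Quaternion.normSq h
    rw [map_mul, map_zero] at this
    exact mul_ne_zero (normSq_ne_zero_of_ne_zero hQ) (normSq_ne_zero_of_ne_zero kQ_ne_zero) this
  rw [qDeg_mul h1 (star_ne_zero_of_ne_zero hQ), qDeg_mul hQ kQ_ne_zero, qDeg_star, qDeg_kQ]
  omega

/-! ### Complex coordinates and primitivity of `Q k Q̄` -/

lemma conj_kQ_re (Q : QPoly) : (Q * kQ * star Q).re = 0 := by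
  simp; ring
lemma conj_kQ_imI (Q : QPoly) :
    (Q * kQ * star Q).imI = 2 * (Q.imI * Q.imK + Q.re * Q.imJ) := by
  simp; ring
lemma conj_kQ_imJ (Q : QPoly) :
    (Q * kQ * star Q).imJ = 2 * (Q.imJ * Q.imK - Q.re * Q.imI) := by
  simp; ring
lemma conj_kQ_imK (Q : QPoly) :
    (Q * kQ * star Q).imK = Q.re ^ 2 + Q.imK ^ 2 - Q.imI ^ 2 - Q.imJ ^ 2 := by
  simp; ring

/-- The complex polynomial with real part `a` and imaginary part `b`. -/
def ofReIm (a b : ℝ[X]) : ℂ[X] :=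
  a.map Complex.ofRealHom + C Complex.I * b.map Complex.ofRealHom

lemma C_I_mul_self : (C Complex.I * C Complex.I : ℂ[X]) = -1 := by
  rw [← C_mul, Complex.I_mul_I]
  simp

lemma ofReIm_mul (a b c d : ℝ[X]) :
    ofReIm a b * ofReIm c d = ofReIm (a * c - b * d) (a * d + b * c) := by
  simp only [ofReIm, Polynomial.map_mul, Polynomial.map_sub, Polynomial.map_add]
  linear_combination (b.map Complex.ofRealHom * d.map Complex.ofRealHom) * C_I_mul_self

lemma ofReIm_injective {a b c d : ℝ[X]} (h : ofReIm a b = ofReIm c d) : a = c ∧ b = d := by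
  have key : ∀ n, (a.coeff n = c.coeff n) ∧ (b.coeff n = d.coeff n) := by
    intro n
    have := congrArg (fun p => p.coeff n) h
    simp only [ofReIm, coeff_add, coeff_map, coeff_C_mul, Complex.ofRealHom_eq_coe] at this
    have h1 := congrArg Complex.re this
    have h2 := congrArg Complex.im this
    simp at h1 h2
    exact ⟨h1, h2⟩
  exact ⟨Polynomial.ext fun n => (key n).1, Polynomial.ext fun n => (key n).2⟩

lemma exists_eq_ofReIm (z : ℂ[X]) : ∃ a b : ℝ[X], z = ofReIm a b := by
  induction z using Polynomial.induction_on' with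
  | add p q hp hq =>
    obtain ⟨a, b, rfl⟩ := hp
    obtain ⟨c, d, rfl⟩ := hq
    refine ⟨a + c, b + d, ?_⟩
    simp only [ofReIm, Polynomial.map_add]
    ring
  | monomial n x =>
    refine ⟨monomial n x.re, monomial n x.im, ?_⟩
    simp only [ofReIm, map_monomial, C_mul_monomial]
    rw [← map_add]
    congr 1
    simpa [mul_comm] using (Complex.re_add_im x).symm

lemma ofReIm_eq_zero_iff {a b : ℝ[X]} : ofReIm a b = 0 ↔ a = 0 ∧ b = 0 := by
  constructor
  · intro h
    exact ofReIm_injective (h.trans (by simp [ofReIm]))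
  · rintro ⟨rfl, rfl⟩
    simp [ofReIm]

/-- Extraction of the greatest common right divisor in `ℝ[t] + ℝ[t] k`. -/
lemma exists_eq_mul_coprime {P : QPoly} (hP : P ≠ 0) : ∃ Q S : QPoly, P = Q * S ∧
    S.imI = 0 ∧ S.imJ = 0 ∧ IsCoprime (ofReIm Q.re Q.imK) (ofReIm Q.imI (-Q.imJ)) := by
  -- The sign in `w = p₁ - i p₂` makes right multiplication by `c₀ + c₃ k` act on both coordinates
  -- as multiplication by `c₀ + i c₃`.
  set z := ofReIm P.re P.imK with hz
  set w := ofReIm P.imI (-P.imJ) with hw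
  have hzw : ¬ (z = 0 ∧ w = 0) := by
    rw [hz, hw, ofReIm_eq_zero_iff, ofReIm_eq_zero_iff]
    rintro ⟨⟨h0, h3⟩, h1, h2⟩
    apply hP
    ext1 <;> simp_all
  obtain ⟨c, z', w', hc, hz', hw'⟩ : ∃ c z' w' : ℂ[X], IsCoprime z' w' ∧ z = z' * c ∧ w = w' * c := by
    have hg : EuclideanDomain.gcd z w ≠ 0 := fun h => hzw (EuclideanDomain.gcd_eq_zero_iff.mp h)
    obtain ⟨z', hz'⟩ := EuclideanDomain.gcd_dvd_left z w
    obtain ⟨w', hw'⟩ := EuclideanDomain.gcd_dvd_right z w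
    refine ⟨EuclideanDomain.gcd z w, z', w', ?_, by rwa [mul_comm], by rwa [mul_comm]⟩
    refine ⟨EuclideanDomain.gcdA z w, EuclideanDomain.gcdB z w, ?_⟩
    apply mul_left_cancel₀ hg
    have := EuclideanDomain.gcd_eq_gcd_ab z w
    generalize EuclideanDomain.gcdA z w = x at *
    generalize EuclideanDomain.gcdB z w = y at *
    generalize EuclideanDomain.gcd z w = g at *
    calc g * (x * z' + y * w') = (g * z') * x + (g * w') * y := by ring
      _ = z * x + w * y := by rw [← hz', ← hw']
      _ = g * 1 := by rw [← this, mul_one]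
  obtain ⟨q0, q3, rfl⟩ := exists_eq_ofReIm z'
  obtain ⟨q1, q2, rfl⟩ := exists_eq_ofReIm w'
  obtain ⟨c0, c3, rfl⟩ := exists_eq_ofReIm c
  rw [hz, ofReIm_mul] at hz'
  rw [hw, ofReIm_mul] at hw'
  obtain ⟨e0, e3⟩ := ofReIm_injective hz'
  obtain ⟨e1, e2⟩ := ofReIm_injective hw'
  obtain ⟨Q, rfl, rfl, hQ2, rfl⟩ : ∃ Q : QPoly, Q.re = q0 ∧ Q.imI = q1 ∧ -Q.imJ = q2 ∧ Q.imK = q3 :=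
    ⟨⟨q0, q1, -q2, q3⟩, rfl, rfl, neg_neg q2, rfl⟩
  obtain ⟨S, rfl, hS1, hS2, rfl⟩ : ∃ S : QPoly, S.re = c0 ∧ S.imI = 0 ∧ S.imJ = 0 ∧ S.imK = c3 :=
    ⟨⟨c0, 0, 0, c3⟩, rfl, rfl, rfl, rfl⟩
  subst hQ2
  refine ⟨Q, S, ?_, hS1, hS2, hc⟩
  ext1 <;> simp only [Quaternion.re_mul, Quaternion.imI_mul, Quaternion.imJ_mul,
    Quaternion.imK_mul, hS1, hS2]
  · linear_combination e0
  · linear_combination e1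
  · linear_combination -e2
  · linear_combination e3

/-- Conjugate the coefficients of a Bézout identity. -/
lemma conj_ofReIm_isCoprime {a b c d : ℝ[X]} (h : IsCoprime (ofReIm a b) (ofReIm c d)) :
    IsCoprime (ofReIm a (-b)) (ofReIm c (-d)) := by
  obtain ⟨x, y, hxy⟩ := h
  obtain ⟨x0, x1, rfl⟩ := exists_eq_ofReIm x
  obtain ⟨y0, y1, rfl⟩ := exists_eq_ofReIm y
  refine ⟨ofReIm x0 (-x1), ofReIm y0 (-y1), ?_⟩
  have one : (1 : ℂ[X]) = ofReIm 1 0 := by simp [ofReIm]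
  have add : ∀ a b c d, ofReIm a b + ofReIm c d = ofReIm (a + c) (b + d) := by
    intro a b c d
    simp only [ofReIm, Polynomial.map_add]
    ring
  rw [ofReIm_mul, ofReIm_mul, add, one] at hxy ⊢
  obtain ⟨h1, h2⟩ := ofReIm_injective hxy
  congr 1
  · rw [← h1]; ring
  · rw [← neg_eq_zero, ← h2]; ring

/-- The coordinates of `Q k Q̄` have no common factor if the complex coordinates of `Q` are
coprime. -/
lemma isUnit_of_dvd_conj_kQ {Q : QPoly}
    (hQ : IsCoprime (ofReIm Q.re Q.imK) (ofReIm Q.imI (-Q.imJ))) {g : ℝ[X]}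
    (h1 : g ∣ (Q * kQ * star Q).imI) (h2 : g ∣ (Q * kQ * star Q).imJ)
    (h3 : g ∣ (Q * kQ * star Q).imK) : IsUnit g := by
  by_contra hg
  have hdeg : (g.map Complex.ofRealHom).degree ≠ 0 := by
    rw [degree_map]
    exact fun h => hg (isUnit_iff_degree_eq_zero.mpr h)
  obtain ⟨t, ht⟩ := IsAlgClosed.exists_root _ hdeg
  have hroot : ∀ p : ℝ[X], g ∣ p → (p.map Complex.ofRealHom).eval t = 0 := by
    rintro p ⟨q, rfl⟩
    rw [Polynomial.map_mul, eval_mul, ht.eq_zero, zero_mul]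
  have r1 := hroot _ h1
  have r2 := hroot _ h2
  have r3 := hroot _ h3
  rw [conj_kQ_imI] at r1
  rw [conj_kQ_imJ] at r2
  rw [conj_kQ_imK] at r3
  obtain ⟨x, y, hxy⟩ := hQ
  obtain ⟨x', y', hxy'⟩ := conj_ofReIm_isCoprime ⟨x, y, hxy⟩
  have e := congrArg (eval t) hxy
  have e' := congrArg (eval t) hxy'
  simp only [ofReIm, eval_add, eval_mul, eval_C, eval_one, Polynomial.map_neg, eval_neg, neg_neg,
    Polynomial.map_mul, Polynomial.map_add, Polynomial.map_sub, Polynomial.map_pow, eval_sub,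
    eval_pow, Polynomial.map_ofNat, eval_ofNat] at e e' r1 r2 r3
  generalize (Q.re.map Complex.ofRealHom).eval t = q0 at *
  generalize (Q.imI.map Complex.ofRealHom).eval t = q1 at *
  generalize (Q.imJ.map Complex.ofRealHom).eval t = q2 at *
  generalize (Q.imK.map Complex.ofRealHom).eval t = q3 at *
  generalize eval t x = x at *
  generalize eval t y = y at *
  generalize eval t x' = x' at *
  generalize eval t y' = y' at *
  -- `Z', W'` are the values at `t` of the conjugate polynomials; they need not be the conjugates of
  -- `Z, W`, since `t` may be non-real. The vanishing of `M` at `t` means `Z W' = Z' W = 0` and `Z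
  -- Z' = W W'`, which forces `Z = W = 0` or `Z' = W' = 0`, against coprimality.
  set Z := q0 + Complex.I * q3 with hZ
  set W := q1 - Complex.I * q2 with hW
  set Z' := q0 - Complex.I * q3 with hZ'
  set W' := q1 + Complex.I * q2 with hW'
  have hI : Complex.I * Complex.I = -1 := Complex.I_mul_I
  have f1 : Z * W' = 0 := by
    rw [hZ, hW']
    linear_combination (Complex.I / 2) * r1 - (1 / 2) * r2 + (q2 * q3) * hI
  have f2 : Z' * W = 0 := by
    rw [hZ', hW]
    linear_combination (-Complex.I / 2) * r1 - (1 / 2) * r2 + (q2 * q3) * hI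
  have f3 : Z * Z' = W * W' := by
    rw [hZ, hZ', hW, hW']
    linear_combination r3 + (q2 ^ 2 - q3 ^ 2) * hI
  have g1 : x * Z + y * W = 1 := by rw [← e]; ring
  have g2 : x' * Z' + y' * W' = 1 := by rw [← e']; ring
  clear_value Z W Z' W'
  clear hZ hW hZ' hW' e e' hxy hxy' r1 r2 r3
  rcases mul_eq_zero.mp f1 with hz | hz <;> rcases mul_eq_zero.mp f2 with hw | hw <;>
    simp_all <;> rcases f3 with h | h <;> simp [h] at g1 g2
-- The reduced primal part
lemma exists_sq_or_neg_sq {u : ℝ} (hu : u ≠ 0) : ∃ v : ℝ, v ≠ 0 ∧ (u * v ^ 2 = 1 ∨ u * v ^ 2 = -1) := by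
  have hp : 0 < |u| := abs_pos.mpr hu
  refine ⟨(√|u|)⁻¹, by positivity, ?_⟩
  rw [inv_pow, Real.sq_sqrt hp.le]
  rcases abs_cases u with ⟨h, _⟩ | ⟨h, _⟩
  · left; rw [h]; field_simp
  · right; rw [h]; field_simp

lemma IsRgcd.ne_zero {P : QPoly} {h : ℝ[X]} (hh : IsRgcd P h) (hP : P ≠ 0) : h ≠ 0 := by
  rintro rfl
  apply hP
  have := (hh 0).mp dvd_rfl
  simp only [zero_dvd_iff] at this
  ext1
  exacts [this.1, this.2.1, this.2.2.1, this.2.2.2]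

/-- Here `S` commutes with `k`, so `S k S̄ = (S S̄) k`. -/
lemma conj_kQ_mul_of_imI_imJ {Q S : QPoly} (h1 : S.imI = 0) (h2 : S.imJ = 0) :
    Q * S * kQ * star (Q * S) = (S.re ^ 2 + S.imK ^ 2) • (Q * kQ * star Q) := by
  ext1 <;> simp [h1, h2] <;> ring

/-- Here `S` anticommutes with `k`, which reverses the sign. This absorbs negative constants. -/
lemma conj_kQ_mul_of_re_imK {Q S : QPoly} (h1 : S.re = 0) (h2 : S.imK = 0) :
    Q * S * kQ * star (Q * S) = (-(S.imI ^ 2 + S.imJ ^ 2)) • (Q * kQ * star Q) := by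
  ext1 <;> simp [h1, h2] <;> ring

/-- If `P k P̄` is a line direction with greatest common divisor `h`, then the reduced direction is
again of the form `Q k Q̄`. -/
lemma exists_conj_kQ_of_isRgcd {P : QPoly} {h : ℝ[X]} (hP : P * kQ * star P ≠ 0)
    (hh : IsRgcd (P * kQ * star P) h) : ∃ Q : QPoly, h • (Q * kQ * star Q) = P * kQ * star P := by
  have hP0 : P ≠ 0 := by
    rintro rfl
    simp at hP
  obtain ⟨Q, S, rfl, hS1, hS2, hc⟩ := exists_eq_mul_coprime hP0
  set g := S.re ^ 2 + S.imK ^ 2 with hg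
  have e : Q * S * kQ * star (Q * S) = g • (Q * kQ * star Q) :=
    conj_kQ_mul_of_imI_imJ hS1 hS2
  rw [e] at hh hP ⊢
  have hgh : g ∣ h := by
    rw [hh]
    simp
  obtain ⟨u, hu⟩ := hgh
  have hu0 : h ≠ 0 := hh.ne_zero hP
  have hg0 : g ≠ 0 := by
    rintro h0
    rw [h0, zero_mul] at hu
    exact hu0 hu
  have hdvd := (hh h).mp dvd_rfl
  rw [hu] at hdvd
  simp only [Quaternion.imI_smul, Quaternion.imJ_smul, Quaternion.imK_smul, smul_eq_mul] at hdvd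
  -- As `g u` divides every coordinate of `g Q k Q̄`, the factor `u` divides the primitive vector `Q
  -- k Q̄`.
  have hunit : IsUnit u := isUnit_of_dvd_conj_kQ hc ((mul_dvd_mul_iff_left hg0).mp hdvd.2.1)
    ((mul_dvd_mul_iff_left hg0).mp hdvd.2.2.1) ((mul_dvd_mul_iff_left hg0).mp hdvd.2.2.2)
  obtain ⟨c, hc', rfl⟩ := Polynomial.isUnit_iff.mp hunit
  obtain ⟨v, -, hv⟩ := exists_sq_or_neg_sq hc'.ne_zero
  have hv' : C c * C v ^ 2 = (1 : ℝ[X]) ∨ C c * C v ^ 2 = (-1 : ℝ[X]) := by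
    rcases hv with hv | hv
    · left; rw [← C_pow, ← C_mul, hv, C_1]
    · right; rw [← C_pow, ← C_mul, hv, C_neg, C_1]
  rcases hv' with hv' | hv'
  · obtain ⟨T, h0, h1, h2, h3⟩ : ∃ T : QPoly, T.re = C v ∧ T.imI = 0 ∧ T.imJ = 0 ∧ T.imK = 0 :=
      ⟨⟨C v, 0, 0, 0⟩, rfl, rfl, rfl, rfl⟩
    refine ⟨Q * T, ?_⟩
    rw [conj_kQ_mul_of_imI_imJ h1 h2, h0, h3, smul_smul, hu]
    congr 1
    linear_combination g * hv'
  · obtain ⟨T, h0, h1, h2, h3⟩ : ∃ T : QPoly, T.re = 0 ∧ T.imI = C v ∧ T.imJ = 0 ∧ T.imK = 0 :=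
      ⟨⟨0, C v, 0, 0⟩, rfl, rfl, rfl, rfl⟩
    refine ⟨Q * T, ?_⟩
    rw [conj_kQ_mul_of_re_imK h0 h3, h1, h2, smul_smul, hu]
    congr 1
    linear_combination -g * hv'

/-- If `h` is a greatest common divisor of `h Q k Q̄`, then `Q` has no real polynomial factor. -/
lemma isUnit_of_dvd_coords {P Q : QPoly} {h g : ℝ[X]} (hP : P ≠ 0) (hh : IsRgcd P h)
    (hQ : h • (Q * kQ * star Q) = P) (h0 : g ∣ (Q * kQ * star Q).imI)
    (h1 : g ∣ (Q * kQ * star Q).imJ) (h2 : g ∣ (Q * kQ * star Q).imK) : IsUnit g := by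
  have hn := hh.ne_zero hP
  have : h * g ∣ h := by
    rw [hh, ← hQ]
    simp only [Quaternion.re_smul, Quaternion.imI_smul, Quaternion.imJ_smul, Quaternion.imK_smul,
      smul_eq_mul, conj_kQ_re, mul_zero, dvd_zero, true_and]
    exact ⟨mul_dvd_mul_left h h0, mul_dvd_mul_left h h1, mul_dvd_mul_left h h2⟩
  obtain ⟨x, hx⟩ := this
  exact IsUnit.of_mul_eq_one x (mul_left_cancel₀ hn (by rw [mul_one, ← mul_assoc, ← hx]))

/-! ### Generic frames -/

/-- A pencil of pairs of polynomials without a common factor has only finitely many members that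
are not coprime. -/
lemma finite_not_isCoprime_pencil {A B A' B' : ℝ[X]} (hD : A * B' - A' * B ≠ 0)
    (hprim : ∀ g, g ∣ A → g ∣ B → g ∣ A' → g ∣ B' → IsUnit g) :
    {s : ℝ | ¬ IsCoprime (A + C s * B) (A' + C s * B')}.Finite := by
  have key : ∀ s : ℝ, ¬ IsCoprime (A + C s * B) (A' + C s * B') →
      ∃ q ∈ UniqueFactorizationMonoid.normalizedFactors (A * B' - A' * B),
        Irreducible q ∧ q ∣ A + C s * B ∧ q ∣ A' + C s * B' := by
    intro s hs
    have : ∃ p, Irreducible p ∧ p ∣ A + C s * B ∧ p ∣ A' + C s * B' := by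
      by_contra! hno
      refine hs (isCoprime_of_irreducible_dvd ?_ hno)
      rintro ⟨h1, h2⟩
      apply hD
      linear_combination B' * h1 - B * h2
    obtain ⟨p, hp, h1, h2⟩ := this
    -- A common factor of a member divides the determinant, which does not depend on `s` and has
    -- finitely many prime factors.
    have hpD : p ∣ A * B' - A' * B := by
      have : A * B' - A' * B = (A + C s * B) * B' - (A' + C s * B') * B := by ring
      rw [this]
      exact dvd_sub (h1.mul_right _) (h2.mul_right _)
    obtain ⟨q, hq, hpq⟩ := UniqueFactorizationMonoid.exists_mem_normalizedFactors_of_dvd hD hp hpD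
    exact ⟨q, hq, hpq.irreducible hp, hpq.symm.dvd.trans h1, hpq.symm.dvd.trans h2⟩
  classical
  choose! f hf hirr h1 h2 using key
  refine Set.Finite.of_injOn (f := f)
    (t := {q | q ∈ UniqueFactorizationMonoid.normalizedFactors (A * B' - A' * B)})
    (fun s hs => hf s hs) ?_ ?_
  -- A prime shared by two different members would divide `A, B, A', B'`.
  · intro s hs t ht hst
    by_contra hne
    have hu : IsUnit (C (s - t) : ℝ[X]) := isUnit_C.mpr (sub_ne_zero.mpr hne).isUnit
    have aux : ∀ X Y : ℝ[X], f s ∣ X + C s * Y → f s ∣ X + C t * Y → f s ∣ X ∧ f s ∣ Y := by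
      intro X Y hX hY
      have e : (X + C s * Y) - (X + C t * Y) = C (s - t) * Y := by
        rw [C_sub]; ring
      have hY' : f s ∣ Y := by
        have := dvd_sub hX hY
        rw [e] at this
        exact (hu.dvd_mul_left).mp this
      exact ⟨(dvd_add_left (hY'.mul_left _)).mp hX, hY'⟩
    have ht1 := h1 t ht
    have ht2 := h2 t ht
    rw [← hst] at ht1 ht2
    obtain ⟨a1, a2⟩ := aux _ _ (h1 s hs) ht1
    obtain ⟨b1, b2⟩ := aux _ _ (h2 s hs) ht2
    exact (hirr s hs).not_isUnit (hprim _ a1 a2 b1 b2)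
  · exact ((UniqueFactorizationMonoid.normalizedFactors (A * B' - A' * B)).toFinset.finite_toSet).subset
      (fun q hq => by simpa only [Finset.mem_coe, Multiset.mem_toFinset, Set.mem_ofPred_eq] using hq)

/-- The two polynomials are the `k`-coordinate and the negative scalar part of `(k + u j - v i) S`.
The condition `u² + v² ≠ 1` will keep `m₃` non-zero. -/
lemma exists_isCoprime_rotation {s0 s1 s2 s3 : ℝ[X]}
    (hprim : ∀ g, g ∣ s0 → g ∣ s1 → g ∣ s2 → g ∣ s3 → IsUnit g) :
    ∃ u v : ℝ, u ^ 2 + v ^ 2 ≠ 1 ∧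
      IsCoprime (s0 - C u * s1 - C v * s2) (s3 + C u * s2 - C v * s1) := by
  by_cases h : ∃ v : ℝ, (s0 - C v * s2) * s2 - (s3 - C v * s1) * (-s1) ≠ 0
  · obtain ⟨v, hv⟩ := h
    have hfin := finite_not_isCoprime_pencil hv (by
      intro g h1 h2 h3 h4
      rw [dvd_neg] at h2
      exact hprim g ((dvd_sub_left (h4.mul_left _)).mp h1) h2 h4
        ((dvd_sub_left (h2.mul_left _)).mp h3))
    have hfin2 : {u : ℝ | u ^ 2 + v ^ 2 = 1}.Finite := by
      refine ((Set.finite_singleton (√(1 - v ^ 2))).union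
        (Set.finite_singleton (-√(1 - v ^ 2)))).subset fun u hu => ?_
      have hu' : u ^ 2 = 1 - v ^ 2 := by
        have : u ^ 2 + v ^ 2 = 1 := hu
        linarith
      have := Real.sqrt_sq_eq_abs u
      rw [hu'] at this
      rcases abs_choice u with h | h
      · left; simp [this, h]
      · right; simp [this, h]
    obtain ⟨u, hu⟩ := (hfin.union hfin2).infinite_compl.nonempty
    simp only [Set.mem_compl_iff, Set.mem_union, Set.mem_ofPred_eq, not_or, not_not] at hu
    refine ⟨u, v, hu.2, ?_⟩
    convert hu.1 using 1 <;> ring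
  · push Not at h
    have h0 := h 0
    have h1 := h 1
    -- The determinants of the pencils for `v = 0` and `v = 1` differ by `s₁² + s₂²`.
    have hs : s1 ^ 2 + s2 ^ 2 = 0 := by
      simp only [C_0, C_1] at h0 h1
      linear_combination h0 - h1
    have hz : s1 = 0 ∧ s2 = 0 := by
      have hx : ∀ x, s1.eval x = 0 ∧ s2.eval x = 0 := by
        intro x
        have := congrArg (eval x) hs
        simp only [eval_add, eval_pow, eval_zero] at this
        constructor <;> nlinarith [sq_nonneg (s1.eval x), sq_nonneg (s2.eval x)]
      exact ⟨Polynomial.funext fun x => by simpa using (hx x).1,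
        Polynomial.funext fun x => by simpa using (hx x).2⟩
    obtain ⟨rfl, rfl⟩ := hz
    refine ⟨0, 0, by norm_num, ?_⟩
    have : IsRelPrime s0 s3 := fun g hg0 hg3 => hprim g hg0 (dvd_zero g) (dvd_zero g) hg3
    simpa using this.isCoprime

/-- Having all coordinates of degree at most that of the last one, in a generic frame. -/
def IsDominated (Q : QPoly) : Prop :=
  Q.imI.natDegree ≤ Q.imK.natDegree ∧ Q.imJ.natDegree ≤ Q.imK.natDegree

lemma constQ_smul (c : ℝ) (r : ℍ[ℝ]) (Q : QPoly) :
    constQ (c • r) * Q = C c • (constQ r * Q) := by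
  ext1 <;> simp <;> ring

lemma IsGeneric.smul {Q : QPoly} (hQ : IsGeneric Q) {c : ℝ} (hc : c ≠ 0) :
    IsGeneric (C c • Q) := by
  obtain ⟨h1, h2, h3⟩ := hQ
  have hC : (C c : ℝ[X]) ≠ 0 := by simpa using hc
  have hu : IsUnit (C c : ℝ[X]) := isUnit_C.mpr hc.isUnit
  refine ⟨?_, ?_, ?_⟩
  · simpa [Quaternion.imK_smul] using ⟨hc, h1⟩
  · rw [conj_kQ_imK] at h2 ⊢
    simp only [Quaternion.re_smul, Quaternion.imI_smul, Quaternion.imJ_smul, Quaternion.imK_smul,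
      smul_eq_mul]
    have := mul_ne_zero (pow_ne_zero 2 hC) h2
    convert this using 1
    ring
  · simp only [Quaternion.re_smul, Quaternion.imK_smul, smul_eq_mul]
    exact (isCoprime_mul_unit_left hu _ _).mpr h3

/-- The coefficient of `m₃` in degree `2N` is `n² (1 - x² - y²)`, and the `k`-coordinate attains the
full degree `N`. -/
lemma isGeneric_of_coeff {R : QPoly} {N : ℕ} {n x y : ℝ} (hN : qDeg R ≤ N) (hn : n ≠ 0)
    (hxy : x ^ 2 + y ^ 2 ≠ 1) (h0 : R.re.coeff N = 0) (h1 : R.imI.coeff N = x * n)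
    (h2 : R.imJ.coeff N = y * n) (h3 : R.imK.coeff N = n) (hc : IsCoprime R.re R.imK) :
    IsGeneric R ∧ IsDominated R := by
  have d0 : R.re.natDegree ≤ N := le_trans (by simp [qDeg]) hN
  have d1 : R.imI.natDegree ≤ N := le_trans (by simp [qDeg]) hN
  have d2 : R.imJ.natDegree ≤ N := le_trans (by simp [qDeg]) hN
  have d3 : R.imK.natDegree ≤ N := le_trans (by simp [qDeg]) hN
  have e3 : N ≤ R.imK.natDegree := le_natDegree_of_ne_zero (by rwa [h3])
  refine ⟨⟨?_, ?_, hc⟩, d1.trans e3, d2.trans e3⟩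
  · intro h
    rw [h, coeff_zero] at h3
    exact hn h3.symm
  · intro h
    have := congrArg (fun p => p.coeff (N + N)) h
    rw [conj_kQ_imK] at this
    simp only [pow_two, coeff_add, coeff_sub, coeff_zero] at this
    rw [coeff_mul_add_eq_of_natDegree_le d0 d0, coeff_mul_add_eq_of_natDegree_le d1 d1,
      coeff_mul_add_eq_of_natDegree_le d2 d2, coeff_mul_add_eq_of_natDegree_le d3 d3, h0, h1, h2,
      h3] at this
    apply hxy
    have h' : n ^ 2 * (x ^ 2 + y ^ 2 - 1) = 0 := by linear_combination -this
    have := (mul_eq_zero.mp h').resolve_left (pow_ne_zero 2 hn)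
    linarith

lemma dvd_coords_mul {R : Type*} [CommRing R] {g : R} {c s : ℍ[R]} (h0 : g ∣ s.re) (h1 : g ∣ s.imI)
    (h2 : g ∣ s.imJ) (h3 : g ∣ s.imK) :
    g ∣ (c * s).re ∧ g ∣ (c * s).imI ∧ g ∣ (c * s).imJ ∧ g ∣ (c * s).imK := by
  simp only [Quaternion.re_mul, Quaternion.imI_mul, Quaternion.imJ_mul, Quaternion.imK_mul]
  have m0 := fun x => h0.mul_left x
  have m1 := fun x => h1.mul_left x
  have m2 := fun x => h2.mul_left x
  have m3 := fun x => h3.mul_left x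
  exact ⟨dvd_sub (dvd_sub (dvd_sub (m0 _) (m1 _)) (m2 _)) (m3 _),
    dvd_sub (dvd_add (dvd_add (m1 _) (m0 _)) (m3 _)) (m2 _),
    dvd_add (dvd_add (dvd_sub (m2 _) (m3 _)) (m0 _)) (m1 _),
    dvd_add (dvd_sub (dvd_add (m3 _) (m2 _)) (m1 _)) (m0 _)⟩

/-- After a suitable rotation of the fixed frame, a polynomial without real factors is generic. -/
lemma exists_rotation_isGeneric {Q : QPoly} (hQ : Q ≠ 0)
    (hprim : ∀ g, g ∣ Q.re → g ∣ Q.imI → g ∣ Q.imJ → g ∣ Q.imK → IsUnit g) :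
    ∃ r : ℍ[ℝ], r * star r = 1 ∧ IsGeneric (constQ r * Q) ∧ IsDominated (constQ r * Q) := by
  set N := qDeg Q with hN
  obtain ⟨c, hc0, hc1, hc2, hc3⟩ : ∃ c : ℍ[ℝ], c.re = Q.re.coeff N ∧ c.imI = Q.imI.coeff N ∧
      c.imJ = Q.imJ.coeff N ∧ c.imK = Q.imK.coeff N :=
    ⟨⟨_, _, _, _⟩, rfl, rfl, rfl, rfl⟩
  have hnc : Quaternion.normSq c ≠ 0 := by
    have h1 := natDegree_normSq Q
    have h2 : (Quaternion.normSq Q).coeff (N + N) ≠ 0 := by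
      rw [← two_mul, ← h1]
      exact leadingCoeff_ne_zero.mpr (normSq_ne_zero_of_ne_zero hQ)
    rw [Quaternion.normSq_def'] at h2 ⊢
    have d0 : Q.re.natDegree ≤ N := by simp [hN, qDeg]
    have d1 : Q.imI.natDegree ≤ N := by simp [hN, qDeg]
    have d2 : Q.imJ.natDegree ≤ N := by simp [hN, qDeg]
    have d3 : Q.imK.natDegree ≤ N := by simp [hN, qDeg]
    simp only [pow_two, coeff_add] at h2
    rw [coeff_mul_add_eq_of_natDegree_le d0 d0, coeff_mul_add_eq_of_natDegree_le d1 d1,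
      coeff_mul_add_eq_of_natDegree_le d2 d2, coeff_mul_add_eq_of_natDegree_le d3 d3] at h2
    rw [hc0, hc1, hc2, hc3]
    simpa only [pow_two] using h2
  have hc : c ≠ 0 := fun h => hnc (by rw [h, map_zero])
  -- This makes the coefficient in degree `N` the real number `c c̄`, so that left multiplication by
  -- `e` below turns it into a multiple of `e`.
  set S := constQ (star c) * Q with hS
  have hS' : constQ c * S = C (Quaternion.normSq c) • Q := by
    rw [hS, ← mul_assoc, ← constQ_mul, Quaternion.self_mul_star]
    ext1 <;> simp
  have hSprim : ∀ g, g ∣ S.re → g ∣ S.imI → g ∣ S.imJ → g ∣ S.imK → IsUnit g := by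
    intro g g0 g1 g2 g3
    have hu : IsUnit (C (Quaternion.normSq c) : ℝ[X]) := isUnit_C.mpr hnc.isUnit
    have aux : g ∣ (constQ c * S).re ∧ g ∣ (constQ c * S).imI ∧ g ∣ (constQ c * S).imJ ∧
        g ∣ (constQ c * S).imK :=
      dvd_coords_mul g0 g1 g2 g3
    rw [hS'] at aux
    simp only [Quaternion.re_smul, Quaternion.imI_smul, Quaternion.imJ_smul, Quaternion.imK_smul,
      smul_eq_mul, hu.dvd_mul_left] at aux
    exact hprim g aux.1 aux.2.1 aux.2.2.1 aux.2.2.2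
  obtain ⟨u, v, huv, hcop⟩ := exists_isCoprime_rotation hSprim
  have k0 : S.re.coeff N = Quaternion.normSq c := by
    rw [Quaternion.normSq_def']
    simp [hS, ← hc0, ← hc1, ← hc2, ← hc3]
    ring
  have k1 : S.imI.coeff N = 0 := by
    simp [hS, ← hc0, ← hc1, ← hc2, ← hc3]
    ring
  have k2 : S.imJ.coeff N = 0 := by
    simp [hS, ← hc0, ← hc1, ← hc2, ← hc3]
    ring
  have k3 : S.imK.coeff N = 0 := by
    simp [hS, ← hc0, ← hc1, ← hc2, ← hc3]
    ring
  obtain ⟨e, he0, he1, he2, he3⟩ : ∃ e : ℍ[ℝ], e.re = 0 ∧ e.imI = -v ∧ e.imJ = u ∧ e.imK = 1 :=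
    ⟨⟨_, _, _, _⟩, rfl, rfl, rfl, rfl⟩
  have he : e ≠ 0 := fun h => by simp [h] at he3
  have hr0 : e * star c ≠ 0 := mul_ne_zero he (star_ne_zero.mpr hc)
  have hRS : constQ (e * star c) * Q = constQ e * S := by rw [constQ_mul, mul_assoc]
  have hgen : IsGeneric (constQ e * S) ∧ IsDominated (constQ e * S) := by
    refine isGeneric_of_coeff (N := N) (n := Quaternion.normSq c) (x := -v) (y := u) ?_ hnc
      (by rw [neg_sq, add_comm]; exact huv) ?_ ?_ ?_ ?_ ?_
    · have hne : constQ (e * star c) ≠ 0 := fun h => by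
        apply hr0
        have hh0 := congrArg (fun q : QPoly => q.re) h
        have hh1 := congrArg (fun q : QPoly => q.imI) h
        have hh2 := congrArg (fun q : QPoly => q.imJ) h
        have hh3 := congrArg (fun q : QPoly => q.imK) h
        simp only [constQ_re, constQ_imI, constQ_imJ, constQ_imK, Quaternion.re_zero,
          Quaternion.imI_zero, Quaternion.imJ_zero, Quaternion.imK_zero, C_eq_zero] at hh0 hh1 hh2 hh3
        ext1 <;> assumption
      rw [← hRS, qDeg_constQ_mul hne]
    · simp [he0, he1, he2, he3, k1, k2, k3]
    · simp [he0, he1, he2, he3, k0, k2, k3]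
    · simp [he0, he1, he2, he3, k0, k1, k3]
    · simp [he0, he1, he2, he3, k0, k1, k2]
    · have := hcop.symm.neg_left
      simp only [Quaternion.re_mul, Quaternion.imK_mul, constQ_re, constQ_imI, constQ_imJ,
        constQ_imK, he0, he1, he2, he3]
      convert this using 1
      · rfl
      · simp only [C_0, C_1, C_neg]; ring
      · simp only [C_0, C_1, C_neg]; ring
  have hpos : 0 < Quaternion.normSq (e * star c) :=
    lt_of_le_of_ne Quaternion.normSq_nonneg (Ne.symm (Quaternion.normSq_ne_zero.mpr hr0))
  set a := (√(Quaternion.normSq (e * star c)))⁻¹ with ha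
  have ha0 : a ≠ 0 := by positivity
  refine ⟨a • (e * star c), ?_, ?_, ?_⟩
  · rw [Quaternion.self_mul_star, Quaternion.normSq_smul, ha, inv_pow, Real.sq_sqrt hpos.le,
      inv_mul_cancel₀ hpos.ne']
    simp
  · rw [constQ_smul, hRS]
    exact hgen.1.smul ha0
  · rw [constQ_smul, hRS]
    have := hgen.2
    unfold IsDominated at this ⊢
    simpa [natDegree_C_mul ha0] using this

/-! ### The linear system for the dual part -/

/-- `D` solves the linear equations for the dual part of a motion polynomial with primal part
`h Q` that moves `k` along a line with dual part `K`. -/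
def SolvesDual (Q K D : QPoly) : Prop :=
  Q * star D + D * star Q = 0 ∧ -(D * kQ * star Q + Q * kQ * star D) = K

lemma solvesDual_iff {Q K D : QPoly} : SolvesDual Q K D ↔ K.re = 0 ∧
    Q.re * D.re + Q.imI * D.imI + Q.imJ * D.imJ + Q.imK * D.imK = 0 ∧
    K.imI = -2 * (D.imJ * Q.re + D.imK * Q.imI + D.re * Q.imJ + D.imI * Q.imK) ∧
    K.imJ = -2 * (D.imK * Q.imJ + D.imJ * Q.imK - D.imI * Q.re - D.re * Q.imI) ∧
    K.imK = -2 * (D.re * Q.re - D.imI * Q.imI - D.imJ * Q.imJ + D.imK * Q.imK) := by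
  have two : (2 : ℝ[X]) ≠ 0 := two_ne_zero
  constructor
  · rintro ⟨h1, rfl⟩
    have h1' := congrArg QuaternionAlgebra.re h1
    simp at h1'
    refine ⟨by simp; ring, mul_left_cancel₀ two (by linear_combination h1'), ?_, ?_, ?_⟩ <;>
      simp <;> ring
  · rintro ⟨h0, h1, h2, h3, h4⟩
    refine ⟨?_, ?_⟩
    · ext1
      · simp; linear_combination 2 * h1
      all_goals simp; ring
    · ext1
      · rw [h0]; simp; ring
      · rw [h2]; simp; ring
      · rw [h3]; simp; ring
      · rw [h4]; simp; ring

/-- `Q k` solves the homogeneous system, because `k̄ = -k`. -/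
lemma SolvesDual.add_smul {Q K D : QPoly} (h : SolvesDual Q K D) (l : ℝ[X]) :
    SolvesDual Q K (D + l • (Q * kQ)) := by
  rw [solvesDual_iff] at h ⊢
  obtain ⟨h0, h1, h2, h3, h4⟩ := h
  refine ⟨h0, ?_, ?_, ?_, ?_⟩
  · simp; linear_combination h1
  · rw [h2]; simp; ring
  · rw [h3]; simp; ring
  · rw [h4]; simp; ring

/-- The Study condition eliminates `d₁` and `d₂` from the third coordinate. -/
lemma SolvesDual.imK_eq {Q K D : QPoly} (h : SolvesDual Q K D) :
    K.imK = -4 * (D.re * Q.re + D.imK * Q.imK) := by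
  obtain ⟨h0, h1, h2, h3, h4⟩ := solvesDual_iff.mp h
  linear_combination h4 + 2 * h1

/-- After substituting for `k₅` and `k₆`, each formula is a multiple of the Study condition. -/
lemma SolvesDual.dualPartFormulas {Q K D : QPoly} (h : SolvesDual Q K D) :
    DualPartFormulas Q K D := by
  obtain ⟨h0, h1, h2, h3, h4⟩ := solvesDual_iff.mp h
  unfold DualPartFormulas
  rw [conj_kQ_imK, h2, h3]
  refine ⟨?_, ?_, ?_⟩
  · linear_combination (2 * (Q.re * Q.imJ - Q.imI * Q.imK)) * h1
  · linear_combination (-2 * (Q.re * Q.imI + Q.imJ * Q.imK)) * h1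
  · linear_combination (2 * (Q.re ^ 2 + Q.imK ^ 2)) * h1

lemma exists_bezout_three {x y z : ℝ[X]} (h : ∀ g, g ∣ x → g ∣ y → g ∣ z → IsUnit g) :
    ∃ a b c, a * x + b * y + c * z = 1 := by
  have h1 : IsRelPrime (EuclideanDomain.gcd x y) z := fun g hg hz =>
    h g (hg.trans (EuclideanDomain.gcd_dvd_left x y)) (hg.trans (EuclideanDomain.gcd_dvd_right x y))
      hz
  obtain ⟨a, b, hab⟩ := h1.isCoprime
  have := EuclideanDomain.gcd_eq_gcd_ab x y
  exact ⟨a * EuclideanDomain.gcdA x y, a * EuclideanDomain.gcdB x y, b, by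
    rw [this] at hab
    linear_combination hab⟩

lemma C_half_mul_two : C (1 / 2 : ℝ) * (2 : ℝ[X]) = 1 := by
  rw [show (2 : ℝ[X]) = C 2 from rfl, ← C_mul]
  norm_num

lemma C_quarter_mul_four : C (1 / 4 : ℝ) * (4 : ℝ[X]) = 1 := by
  rw [show (4 : ℝ[X]) = C 4 from rfl, ← C_mul]
  norm_num

/-- The linear equations for the dual part are solvable if the coordinates of `Q k Q̄` have no
common factor. -/
lemma exists_solvesDual {Q K : QPoly} (hK0 : K.re = 0)
    (hK : (Q * kQ * star Q).imI * K.imI + (Q * kQ * star Q).imJ * K.imJ +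
      (Q * kQ * star Q).imK * K.imK = 0)
    (hprim : ∀ g, g ∣ (Q * kQ * star Q).imI → g ∣ (Q * kQ * star Q).imJ →
      g ∣ (Q * kQ * star Q).imK → IsUnit g) : ∃ D, SolvesDual Q K D := by
  obtain ⟨a, b, c, habc⟩ := exists_bezout_three hprim
  rw [conj_kQ_imI, conj_kQ_imJ, conj_kQ_imK] at hK habc
  obtain ⟨x, hx⟩ : ∃ x, K.imI = 2 * x := ⟨C (1 / 2) * K.imI, by
    linear_combination -K.imI * C_half_mul_two⟩
  obtain ⟨y, hy⟩ : ∃ y, K.imJ = 2 * y := ⟨C (1 / 2) * K.imJ, by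
    linear_combination -K.imJ * C_half_mul_two⟩
  obtain ⟨z, hz⟩ : ∃ z, K.imK = 2 * z := ⟨C (1 / 2) * K.imK, by
    linear_combination -K.imK * C_half_mul_two⟩
  -- With `κ = K / 2` and `α = (a, b, c)`, put `X = κ × α`. Then `M × X = κ (M · α) - α (M · κ) =
  -- κ`.
  obtain ⟨X, X0, X1, X2, X3⟩ : ∃ X : QPoly, X.re = 0 ∧ X.imI = y * c - z * b ∧
      X.imJ = z * a - x * c ∧ X.imK = x * b - y * a := ⟨⟨_, _, _, _⟩, rfl, rfl, rfl, rfl⟩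
  refine ⟨X * Q, solvesDual_iff.mpr ⟨hK0, ?_, ?_, ?_, ?_⟩⟩ <;>
    simp only [Quaternion.re_mul, Quaternion.imI_mul, Quaternion.imJ_mul, Quaternion.imK_mul,
      X0, X1, X2, X3, hx, hy, hz] at hK ⊢
  · ring
  · linear_combination (-2 * x) * habc + a * hK
  · linear_combination (-2 * y) * habc + b * hK
  · linear_combination (-2 * z) * habc + c * hK

/-- The free parameter can be chosen such that the scalar part is `-k₇ a / 4`. -/
lemma SolvesDual.exists_re_eq {Q K D : QPoly} (h : SolvesDual Q K D) {a b : ℝ[X]}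
    (hab : a * Q.re + b * Q.imK = 1) :
    ∃ D, SolvesDual Q K D ∧ D.re = -(C (1 / 4 : ℝ) * K.imK * a) := by
  -- The scalar part of `Q k` is `-q₃`, so by Bézout the new scalar part is `a (d₀ q₀ + d₃ q₃) = -k₇
  -- a / 4`.
  refine ⟨_, h.add_smul (b * D.re - a * D.imK), ?_⟩
  have := h.imK_eq
  rw [this]
  simp only [Quaternion.re_add, Quaternion.re_smul, Quaternion.re_mul, kQ_re, kQ_imI, kQ_imJ,
    kQ_imK, smul_eq_mul]
  linear_combination (-D.re) * hab +
    (-(D.re * Q.re + D.imK * Q.imK) * a) * C_quarter_mul_four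

/-! ### Degree bound for the dual part -/

section Degree

lemma natDegree_add_le_of_le' {p q : ℝ[X]} {m : ℕ} (hp : p.natDegree ≤ m) (hq : q.natDegree ≤ m) :
    (p + q).natDegree ≤ m := natDegree_add_le_of_degree_le hp hq

lemma natDegree_sub_le_of_le' {p q : ℝ[X]} {m : ℕ} (hp : p.natDegree ≤ m) (hq : q.natDegree ≤ m) :
    (p - q).natDegree ≤ m := (natDegree_sub_le_of_le hp hq).trans (max_self m).le

lemma natDegree_mul_le_of_le' {p q : ℝ[X]} {m n k : ℕ} (hp : p.natDegree ≤ m)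
    (hq : q.natDegree ≤ n) (hk : m + n ≤ k) : (p * q).natDegree ≤ k :=
  (natDegree_mul_le_of_le hp hq).trans hk

lemma natDegree_le_of_mul_le {p q : ℝ[X]} {m : ℕ} (hq : q ≠ 0)
    (h : (p * q).natDegree ≤ m + q.natDegree) : p.natDegree ≤ m := by
  rcases eq_or_ne p 0 with rfl | hp
  · simp
  · rw [natDegree_mul hp hq] at h
    omega

lemma natDegree_C_mul_le' {p : ℝ[X]} {m : ℕ} (c : ℝ) (hp : p.natDegree ≤ m) :
    (C c * p).natDegree ≤ m := (natDegree_C_mul_le c p).trans hp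

/-- If the scalar part of a solution has degree at most `deg q₃`, then the whole solution has
small degree. -/
lemma SolvesDual.qDeg_le {Q K D : QPoly} (h : SolvesDual Q K D) (hQ : Q.imK ≠ 0)
    (hdom : IsDominated Q) (hre : D.re.natDegree ≤ Q.imK.natDegree) {e : ℕ}
    (hKdeg : qDeg K ≤ e + 2 * qDeg Q)
    (hK : (Q * kQ * star Q).imI * K.imI + (Q * kQ * star Q).imJ * K.imJ +
      (Q * kQ * star Q).imK * K.imK = 0) :
    qDeg D ≤ e + qDeg Q := by
  obtain ⟨-, -, h2, h3, -⟩ := solvesDual_iff.mp h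
  have h4 := h.imK_eq
  rw [conj_kQ_imI, conj_kQ_imJ, conj_kQ_imK] at hK
  obtain ⟨hd1, hd2⟩ := hdom
  set n := qDeg Q with hn
  set s := Q.imK.natDegree with hs
  have hn' : n = max Q.re.natDegree s := by
    rw [hn, qDeg]
    omega
  have q0 : Q.re.natDegree ≤ n := by omega
  have q1 : Q.imI.natDegree ≤ n := by omega
  have q2 : Q.imJ.natDegree ≤ n := by omega
  have q3 : Q.imK.natDegree ≤ n := by omega
  have k1 : K.imI.natDegree ≤ e + 2 * n := le_trans (by simp [qDeg]) hKdeg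
  have k2 : K.imJ.natDegree ≤ e + 2 * n := le_trans (by simp [qDeg]) hKdeg
  have k3 : K.imK.natDegree ≤ e + 2 * n := le_trans (by simp [qDeg]) hKdeg
  -- Only `s < n` needs an argument: then `q₀` alone has degree `n`, so `m₃` has degree exactly
  -- `2n`, while `m₁, m₂` have degree at most `n + s`. The Plücker relation `m₃ k₇ = -(m₁ k₅ + m₂
  -- k₆)` gains the missing `n - s`.
  have k3' : K.imK.natDegree ≤ e + n + s := by
    rcases Nat.lt_or_ge s n with hlt | hge
    · have hr : Q.re.natDegree = n := by omega
      have hm : (Q.re ^ 2 + Q.imK ^ 2 - Q.imI ^ 2 - Q.imJ ^ 2).natDegree = 2 * n := by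
        have e1 : Q.re ^ 2 + Q.imK ^ 2 - Q.imI ^ 2 - Q.imJ ^ 2 =
            Q.re ^ 2 + (Q.imK ^ 2 - Q.imI ^ 2 - Q.imJ ^ 2) := by ring
        have e2 : (Q.imK ^ 2 - Q.imI ^ 2 - Q.imJ ^ 2).natDegree ≤ 2 * s :=
          natDegree_sub_le_of_le' (natDegree_sub_le_of_le' (natDegree_pow_le_of_le 2 le_rfl)
            (natDegree_pow_le_of_le 2 hd1)) (natDegree_pow_le_of_le 2 hd2)
        have e3 : (Q.re ^ 2).natDegree = 2 * n := by rw [natDegree_pow, hr]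
        rw [e1, natDegree_add_eq_left_of_natDegree_lt (by omega), e3]
      refine natDegree_le_of_mul_le (q := Q.re ^ 2 + Q.imK ^ 2 - Q.imI ^ 2 - Q.imJ ^ 2) ?_ ?_
      · intro h0
        rw [h0, natDegree_zero] at hm
        omega
      have e1 : K.imK * (Q.re ^ 2 + Q.imK ^ 2 - Q.imI ^ 2 - Q.imJ ^ 2) =
          C (-2) * ((Q.imI * Q.imK + Q.re * Q.imJ) * K.imI +
            (Q.imJ * Q.imK - Q.re * Q.imI) * K.imJ) := by
        rw [show (C (-2) : ℝ[X]) = -2 by rw [C_neg]; rfl]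
        linear_combination hK
      rw [e1, hm]
      have m1 : (Q.imI * Q.imK + Q.re * Q.imJ).natDegree ≤ n + s := natDegree_add_le_of_le'
        (natDegree_mul_le_of_le' q1 le_rfl le_rfl) (natDegree_mul_le_of_le' q0 hd2 le_rfl)
      have m2 : (Q.imJ * Q.imK - Q.re * Q.imI).natDegree ≤ n + s := natDegree_sub_le_of_le'
        (natDegree_mul_le_of_le' q2 le_rfl le_rfl) (natDegree_mul_le_of_le' q0 hd1 le_rfl)
      exact natDegree_C_mul_le' _ (natDegree_add_le_of_le'
        (natDegree_mul_le_of_le' m1 k1 (by omega)) (natDegree_mul_le_of_le' m2 k2 (by omega)))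
    · omega
  have d3 : D.imK.natDegree ≤ e + n := by
    refine natDegree_le_of_mul_le hQ ?_
    have e1 : D.imK * Q.imK = C (-1 / 4) * K.imK - D.re * Q.re := by
      rw [show (C (-1 / 4) : ℝ[X]) = -C (1 / 4) by rw [← C_neg]; norm_num]
      linear_combination (C (1 / 4)) * h4 - (D.re * Q.re + D.imK * Q.imK) * C_quarter_mul_four
    rw [e1]
    exact natDegree_sub_le_of_le' (natDegree_C_mul_le' _ k3')
      (natDegree_mul_le_of_le' hre q0 (by omega))
  -- With `d₀` and `d₃` bounded, the equations for `k₅` and `k₆` become a 2×2 system for `d₁, d₂`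
  -- with determinant `q₀² + q₃²`, of degree exactly `2n`.
  obtain ⟨A, hA, hAe⟩ : ∃ A : ℝ[X], A.natDegree ≤ e + 2 * n ∧ D.imI * Q.imK + D.imJ * Q.re = A :=
    ⟨C (-1 / 2) * K.imI - D.imK * Q.imI - D.re * Q.imJ,
      natDegree_sub_le_of_le' (natDegree_sub_le_of_le' (natDegree_C_mul_le' _ k1)
        (natDegree_mul_le_of_le' d3 q1 (by omega))) (natDegree_mul_le_of_le' hre q2 (by omega)), by
      rw [show (C (-1 / 2) : ℝ[X]) = -C (1 / 2) by rw [← C_neg]; norm_num, h2]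
      linear_combination -(D.imJ * Q.re + D.imK * Q.imI + D.re * Q.imJ + D.imI * Q.imK) *
        C_half_mul_two⟩
  obtain ⟨B, hB, hBe⟩ : ∃ B : ℝ[X], B.natDegree ≤ e + 2 * n ∧ D.imJ * Q.imK - D.imI * Q.re = B :=
    ⟨C (-1 / 2) * K.imJ - D.imK * Q.imJ + D.re * Q.imI,
      natDegree_add_le_of_le' (natDegree_sub_le_of_le' (natDegree_C_mul_le' _ k2)
        (natDegree_mul_le_of_le' d3 q2 (by omega))) (natDegree_mul_le_of_le' hre q1 (by omega)), by
      rw [show (C (-1 / 2) : ℝ[X]) = -C (1 / 2) by rw [← C_neg]; norm_num, h3]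
      linear_combination -(D.imK * Q.imJ + D.imJ * Q.imK - D.imI * Q.re - D.re * Q.imI) *
        C_half_mul_two⟩
  have hsq : (Q.re ^ 2 + Q.imK ^ 2).natDegree = 2 * n := by
    rw [natDegree_sq_add_sq, ← hs, ← hn']
  have hsq0 : Q.re ^ 2 + Q.imK ^ 2 ≠ 0 := by
    intro h0
    apply hQ
    refine Polynomial.funext fun x => ?_
    have := congrArg (eval x) h0
    simp only [eval_add, eval_pow, eval_zero] at this ⊢
    nlinarith [sq_nonneg (Q.re.eval x), sq_nonneg (Q.imK.eval x)]
  have d1 : D.imI.natDegree ≤ e + n := by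
    refine natDegree_le_of_mul_le hsq0 ?_
    have e1 : D.imI * (Q.re ^ 2 + Q.imK ^ 2) = A * Q.imK - B * Q.re := by
      rw [← hAe, ← hBe]
      ring
    rw [e1, hsq]
    exact natDegree_sub_le_of_le' (natDegree_mul_le_of_le' hA q3 (by omega))
      (natDegree_mul_le_of_le' hB q0 (by omega))
  have d2 : D.imJ.natDegree ≤ e + n := by
    refine natDegree_le_of_mul_le hsq0 ?_
    have e1 : D.imJ * (Q.re ^ 2 + Q.imK ^ 2) = A * Q.re + B * Q.imK := by
      rw [← hAe, ← hBe]
      ring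
    rw [e1, hsq]
    exact natDegree_add_le_of_le' (natDegree_mul_le_of_le' hA q0 (by omega))
      (natDegree_mul_le_of_le' hB q3 (by omega))
  have d0 : D.re.natDegree ≤ e + n := by omega
  simp only [qDeg, max_le_iff]
  exact ⟨⟨d0, d1⟩, d2, d3⟩

end Degree

/-! ### Scaling, conjugation and line polynomials -/

section Conjugation

variable {R : Type*} [CommRing R]

lemma exists_eq_smul_of_dvd {g : R} {P : ℍ[R]} (h0 : g ∣ P.re) (h1 : g ∣ P.imI) (h2 : g ∣ P.imJ)
    (h3 : g ∣ P.imK) : ∃ P', P = g • P' := by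
  obtain ⟨p0, h0⟩ := h0
  obtain ⟨p1, h1⟩ := h1
  obtain ⟨p2, h2⟩ := h2
  obtain ⟨p3, h3⟩ := h3
  refine ⟨⟨p0, p1, p2, p3⟩, ?_⟩
  ext1 <;> assumption

lemma re_mul_mul_star (s P : ℍ[R]) : (s * P * star s).re = Quaternion.normSq s * P.re := by
  rw [Quaternion.normSq_def']
  simp
  ring

lemma conj_mul_star_conj {s : ℍ[R]} (e : star s * s = 1) (X Y : ℍ[R]) :
    s * X * star s * star (s * Y * star s) = s * (X * star Y) * star s := by
  calc s * X * star s * star (s * Y * star s) = s * X * (star s * s) * star Y * star s := by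
        simp [mul_assoc]
    _ = s * (X * star Y) * star s := by rw [e]; simp [mul_assoc]

lemma normSq_eq_one {s : ℍ[R]} (e : s * star s = 1) : Quaternion.normSq s = 1 := by
  rw [Quaternion.normSq_def, e]
  rfl

lemma conj_smul (h : R) (s X : ℍ[R]) : s * (h • X) * star s = h • (s * X * star s) := by
  rw [mul_smul_comm, smul_mul_assoc]

lemma smul_conj_polar (h : R) (Q D k : ℍ[R]) :
    -(D * k * star (h • Q) + h • Q * k * star D) = h • -(D * k * star Q + Q * k * star D) := by
  rw [Quaternion.star_smul, mul_smul_comm, smul_mul_assoc, smul_mul_assoc, ← smul_add, smul_neg]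

lemma smul_polar (h : R) (Q D : ℍ[R]) :
    h • Q * star D + D * star (h • Q) = h • (Q * star D + D * star Q) := by
  rw [Quaternion.star_smul, mul_smul_comm, smul_mul_assoc, smul_add]

lemma smul_conj (h : R) (Q k : ℍ[R]) :
    h • Q * k * star (h • Q) = h • h • (Q * k * star Q) := by
  rw [Quaternion.star_smul, mul_smul_comm, smul_mul_assoc, smul_mul_assoc]

lemma conj_add (s X Y : ℍ[R]) : s * X * star s + s * Y * star s = s * (X + Y) * star s := by
  rw [mul_add, add_mul]

lemma conj_conj_star {s : ℍ[R]} (e : star s * s = 1) (X : ℍ[R]) :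
    star s * (s * X * star s) * s = X := by
  calc star s * (s * X * star s) * s = (star s * s) * X * (star s * s) := by simp [mul_assoc]
    _ = X := by rw [e]; simp

lemma star_mul_smul_mul {s : ℍ[R]} (e : star s * s = 1) (h : R) (X : ℍ[R]) :
    star s * (h • (s * X)) = h • X := by
  rw [mul_smul_comm, ← mul_assoc, e, one_mul]

end Conjugation

lemma qDeg_conj {s : QPoly} (e : s * star s = 1) (P : QPoly) :
    qDeg (s * P * star s) = qDeg P := by
  have h1 := natDegree_normSq (s * P * star s)
  rw [map_mul, map_mul, Quaternion.normSq_star, normSq_eq_one e, one_mul, mul_one,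
    natDegree_normSq] at h1
  omega

lemma smul_ne_zero_qPoly {h : ℝ[X]} {P : QPoly} (hh : h ≠ 0) (hP : P ≠ 0) : h • P ≠ 0 := by
  intro h0
  have := congrArg Quaternion.normSq h0
  rw [Quaternion.normSq_smul, map_zero] at this
  exact mul_ne_zero (pow_ne_zero 2 hh) (normSq_ne_zero_of_ne_zero hP) this

/-- Rotating the fixed frame preserves line polynomials. -/
lemma IsLinePolynomial.rotate {L : DQPoly} (hL : IsLinePolynomial L) {r : ℍ[ℝ]}
    (hr : r * star r = 1) : IsLinePolynomial (constD r * L * constD (star r)) := by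
  obtain ⟨h1, h2, h3, h4⟩ := hL
  have e1 := constQ_mul_star hr
  have e2 := star_mul_constQ hr
  unfold IsLinePolynomial
  simp only [primal_mul, dual_mul, primal_constD, dual_constD, constQ_star, zero_mul, zero_add,
    add_zero, mul_zero]
  generalize constQ r = s at *
  refine ⟨?_, ?_, ?_, ?_⟩
  · rw [re_mul_mul_star, h1, mul_zero]
  · rw [re_mul_mul_star, h2, mul_zero]
  · rw [conj_mul_star_conj e2, conj_mul_star_conj e2, conj_add, h3, mul_zero, zero_mul]
  · intro h0
    apply h4
    rw [← conj_conj_star e2 (primal L), h0, mul_zero, zero_mul]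

/-- The Plücker condition in coordinates, after division by the greatest common divisor. -/
lemma IsLinePolynomial.dot_eq_zero {L : DQPoly} (hL : IsLinePolynomial L) {h : ℝ[X]} {M : QPoly}
    (hM : h • M = primal L) (hM0 : M.re = 0) :
    M.imI * (dual L).imI + M.imJ * (dual L).imJ + M.imK * (dual L).imK = 0 := by
  obtain ⟨h1, h2, h3, h4⟩ := hL
  have hh : h ≠ 0 := by
    rintro rfl
    apply h4
    rw [← hM]
    ext1 <;> simp
  rw [← hM] at h3
  have := congrArg QuaternionAlgebra.re h3
  simp [hM0] at this
  have h2h : 2 * h ≠ 0 := mul_ne_zero two_ne_zero hh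
  apply mul_left_cancel₀ h2h
  linear_combination this

/-! ### From the linear system to motion polynomials -/

lemma SolvesDual.isSolution {h : ℝ[X]} {L : DQPoly} {Q D : QPoly} (hh : h ≠ 0) (hQ0 : Q ≠ 0)
    (hQ : h • (Q * kQ * star Q) = primal L) (hD : SolvesDual Q (dual L) D) :
    IsSolution h L (mkDual (h • Q) D) := by
  obtain ⟨h1, h2⟩ := hD
  rw [isSolution_iff, primal_mkDual, dual_mkDual]
  refine ⟨⟨?_, smul_ne_zero_qPoly hh hQ0⟩, ?_, ?_⟩
  · rw [smul_polar, h1]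
    ext1 <;> simp
  · rw [smul_conj, hQ]
  · rw [smul_conj_polar, h2]

/-- The degree of a solution whose dual part satisfies the degree bound. -/
lemma two_mul_dqDeg_eq {h : ℝ[X]} {L A : DQPoly} {Q : QPoly} (hh : h ≠ 0) (hQ0 : Q ≠ 0)
    (hQ : h • (Q * kQ * star Q) = primal L) (hL : qDeg (dual L) ≤ qDeg (primal L))
    (hA : qDeg (primal A) = h.natDegree + qDeg Q) (hA' : qDeg (dual A) ≤ h.natDegree + qDeg Q) :
    2 * dqDeg A = dqDeg L + h.natDegree := by
  have hM : Q * kQ * star Q ≠ 0 := fun h0 => by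
    have := congrArg Quaternion.normSq h0
    rw [map_mul, map_mul, map_zero, Quaternion.normSq_star] at this
    exact mul_ne_zero (mul_ne_zero (normSq_ne_zero_of_ne_zero hQ0)
      (normSq_ne_zero_of_ne_zero kQ_ne_zero)) (normSq_ne_zero_of_ne_zero hQ0) this
  have e : qDeg (primal L) = h.natDegree + 2 * qDeg Q := by
    rw [← hQ, qDeg_smul hh hM, qDeg_conj_kQ hQ0]
  unfold dqDeg
  omega

/-- The explicit formulas for the dual part in a generic rotated frame. -/
lemma exists_dualPart_rotate {L : DQPoly} (hL : IsLinePolynomial L) {h : ℝ[X]}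
    (hh : IsRgcd (primal L) h) {Q : QPoly} (hQ : h • (Q * kQ * star Q) = primal L)
    (r : ℍ[ℝ]) (R : QPoly) (L' : DQPoly) (hr : r * star r = 1) (hR : R = constQ r * Q)
    (hL' : L' = constD r * L * constD (star r)) (hgen : IsGeneric R) (a b : ℝ[X])
    (hab : a * R.re + b * R.imK = 1) :
    ∃ D : QPoly, D.re = -(C (1 / 4 : ℝ) * (dual L').imK * a) ∧
      DualPartFormulas R (dual L') D ∧
      ∀ lam rho : ℝ[X], D.re = lam * R.imK + rho → rho.degree < R.imK.degree →
        ∀ C' : DQPoly, C' = mkDual (h • R) (D + lam • (R * kQ)) →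
          IsSolution h L' C' ∧
          primal (constD (star r) * C') = h • Q ∧
          IsSolution h L (constD (star r) * C') ∧
          (qDeg (dual L) ≤ qDeg (primal L) →
            R.imI.natDegree ≤ R.imK.natDegree → R.imJ.natDegree ≤ R.imK.natDegree →
              2 * dqDeg (constD (star r) * C') = dqDeg L + h.natDegree) := by
  have hh0 : h ≠ 0 := hh.ne_zero hL.2.2.2
  have e1 := constQ_mul_star hr
  have e2 := star_mul_constQ hr
  have hR0 : R ≠ 0 := by
    intro h0
    apply hgen.1
    rw [h0]
    rfl
  have hQ0 : Q ≠ 0 := by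
    rintro rfl
    exact hR0 (by rw [hR, mul_zero])
  have hline' : IsLinePolynomial L' := hL' ▸ hL.rotate hr
  have hp : primal L' = constQ r * primal L * star (constQ r) := by
    rw [hL']
    simp only [primal_mul, primal_constD, constQ_star]
  have hd : dual L' = constQ r * dual L * star (constQ r) := by
    rw [hL']
    simp only [primal_mul, dual_mul, primal_constD, dual_constD, constQ_star, zero_mul, zero_add,
      add_zero, mul_zero]
  have hM : R * kQ * star R = constQ r * (Q * kQ * star Q) * star (constQ r) := by
    rw [hR, star_mul]
    simp only [mul_assoc]
  have hRL : h • (R * kQ * star R) = primal L' := by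
    rw [hM, ← conj_smul, hQ, hp]
  have hdot := hline'.dot_eq_zero hRL (conj_kQ_re R)
  -- Rotating back, a real factor of `R k R̄` is a factor of `Q k Q̄`.
  have hprim : ∀ g, g ∣ (R * kQ * star R).imI → g ∣ (R * kQ * star R).imJ →
      g ∣ (R * kQ * star R).imK → IsUnit g := by
    intro g g1 g2 g3
    obtain ⟨M', hM'⟩ := exists_eq_smul_of_dvd (by rw [conj_kQ_re]; exact dvd_zero g) g1 g2 g3
    have hMQ : Q * kQ * star Q = g • (star (constQ r) * M' * constQ r) := by
      rw [← conj_conj_star e2 (Q * kQ * star Q), ← hM, hM']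
      have := conj_smul g (star (constQ r)) M'
      rwa [star_star] at this
    refine isUnit_of_dvd_coords hL.2.2.2 hh hQ ?_ ?_ ?_ <;> rw [hMQ]
    exacts [Dvd.intro _ rfl, Dvd.intro _ rfl, Dvd.intro _ rfl]
  obtain ⟨D₀, hD₀⟩ := exists_solvesDual hline'.2.1 hdot hprim
  obtain ⟨D, hD, hDre⟩ := hD₀.exists_re_eq hab
  refine ⟨D, hDre, hD.dualPartFormulas, ?_⟩
  rintro lam rho hdiv hrho C' rfl
  have hsol := (hD.add_smul lam).isSolution hh0 hR0 hRL
  have hprimal : primal (constD (star r) * mkDual (h • R) (D + lam • (R * kQ))) = h • Q := by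
    rw [primal_mul, primal_constD, primal_mkDual, constQ_star, hR, star_mul_smul_mul e2]
  refine ⟨hsol, hprimal, (hL' ▸ hsol).rotate hr, fun hdeg hd1 hd2 => ?_⟩
  have hrne : constQ (star r) ≠ 0 := by
    rw [constQ_star]
    intro h0
    rw [h0, zero_mul] at e2
    exact zero_ne_one e2
  have hRQ : qDeg R = qDeg Q := by
    refine hR ▸ qDeg_constQ_mul ?_ Q
    intro h0
    rw [h0, zero_mul] at e1
    exact zero_ne_one e1
  refine two_mul_dqDeg_eq hh0 hQ0 hQ hdeg (by rw [hprimal, qDeg_smul hh0 hQ0]) ?_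
  have hdual : dual (constD (star r) * mkDual (h • R) (D + lam • (R * kQ))) =
      constQ (star r) * (D + lam • (R * kQ)) := by
    rw [dual_mul, dual_constD, zero_mul, add_zero, primal_constD, dual_mkDual]
  rw [hdual, qDeg_constQ_mul hrne, ← hRQ]
  refine (hD.add_smul lam).qDeg_le hgen.1 ⟨hd1, hd2⟩ ?_ ?_ hdot
  -- The scalar part of `R k` is `-q₃`, so adding `λ R k` reduces `d₀` to its remainder.
  · have : (D + lam • (R * kQ)).re = rho := by
      rw [Quaternion.re_add, hdiv]
      simp
    rw [this]
    exact natDegree_le_natDegree hrho.le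
  · have hM0 : Q * kQ * star Q ≠ 0 := by
      intro h0
      apply hL.2.2.2
      rw [← hQ, h0]
      ext1 <;> simp
    rw [hd, qDeg_conj e1]
    refine hdeg.trans ?_
    rw [← hQ, qDeg_smul hh0 hM0, qDeg_conj_kQ hQ0, hRQ]
end

theorem theorem1 (L : DQPoly) (hline : IsLinePolynomial L) (hkin : IsKinematic L)
    (hsat : IsSaturated L) (h : ℝ[X]) (hh : IsRgcd (primal L) h) :
    -- the primal part: `Q k Q̄ = L_p / h` is solvable
    (∃ Q : QPoly, h • (Q * kQ * star Q) = primal L) ∧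
    ∀ Q : QPoly, h • (Q * kQ * star Q) = primal L →
      -- existence of the motion polynomial `C = Q h + ε D`, and its degree
      (∃ D : QPoly, IsSolution h L (mkDual (h • Q) D) ∧
        (qDeg (dual L) ≤ qDeg (primal L) →
          2 * dqDeg (mkDual (h • Q) D) = dqDeg L + h.natDegree)) ∧
      -- the genericity assumptions hold after a suitable rotation of the fixed frame
      (∃ r : ℍ[ℝ], r * star r = 1 ∧ IsGeneric (constQ r * Q) ∧
        (constQ r * Q).imI.natDegree ≤ (constQ r * Q).imK.natDegree ∧
        (constQ r * Q).imJ.natDegree ≤ (constQ r * Q).imK.natDegree) ∧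
      -- the explicit formulas, in any rotated frame in which `r Q` is generic
      (∀ (r : ℍ[ℝ]) (R : QPoly) (L' : DQPoly), r * star r = 1 → R = constQ r * Q →
        L' = constD r * L * constD (star r) → IsGeneric R →
        ∀ a b : ℝ[X], a * R.re + b * R.imK = 1 →
          ∃ D : QPoly, D.re = -(C (1 / 4 : ℝ) * (dual L').imK * a) ∧
            DualPartFormulas R (dual L') D ∧
            ∀ lam rho : ℝ[X], D.re = lam * R.imK + rho → rho.degree < R.imK.degree →
              ∀ C' : DQPoly, C' = mkDual (h • R) (D + lam • (R * kQ)) →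
                IsSolution h L' C' ∧
                primal (constD (star r) * C') = h • Q ∧
                IsSolution h L (constD (star r) * C') ∧
                (qDeg (dual L) ≤ qDeg (primal L) →
                  R.imI.natDegree ≤ R.imK.natDegree → R.imJ.natDegree ≤ R.imK.natDegree →
                    2 * dqDeg (constD (star r) * C') = dqDeg L + h.natDegree)) := by
  have hne : primal L ≠ 0 := hline.2.2.2
  refine ⟨?_, fun Q hQ => ?_⟩
  · obtain ⟨-, P, hP⟩ := hsat.1
    have hP' : P * kQ * star P = primal L := by rw [← hP, one_smul]
    obtain ⟨Q, hQ⟩ := exists_conj_kQ_of_isRgcd (by rwa [hP']) (by rwa [hP'])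
    exact ⟨Q, hQ.trans hP'⟩
  have hrot : ∃ r : ℍ[ℝ], r * star r = 1 ∧ IsGeneric (constQ r * Q) ∧
      IsDominated (constQ r * Q) := by
    refine exists_rotation_isGeneric ?_ fun g g0 g1 g2 g3 => ?_
    · rintro rfl
      apply hne
      rw [← hQ, zero_mul, zero_mul]
      ext1 <;> simp
    -- A real factor of `Q` divides the coordinates of `Q k Q̄`, which are quadratic in those of
    -- `Q`.
    · refine isUnit_of_dvd_coords hne hh hQ ?_ ?_ ?_
      · rw [conj_kQ_imI]
        exact (dvd_add (g1.mul_right _) (g0.mul_right _)).mul_left 2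
      · rw [conj_kQ_imJ]
        exact (dvd_sub (g2.mul_right _) (g0.mul_right _)).mul_left 2
      · rw [conj_kQ_imK]
        exact dvd_sub (dvd_sub (dvd_add (g0.pow two_ne_zero) (g3.pow two_ne_zero))
          (g1.pow two_ne_zero)) (g2.pow two_ne_zero)
  refine ⟨?_, hrot, exists_dualPart_rotate hline hh hQ⟩
  -- Part (a) is read off from the explicit solution in a generic dominated frame, rotated back.
  obtain ⟨r, hr, hgen, hdom⟩ := hrot
  obtain ⟨a, b, hab⟩ := hgen.2.2
  obtain ⟨D, -, -, hD⟩ := exists_dualPart_rotate hline hh hQ r _ _ hr rfl rfl hgen a b hab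
  obtain ⟨-, hprimal, hsol, hdeg⟩ := hD (D.re / (constQ r * Q).imK) (D.re % (constQ r * Q).imK)
    (by rw [mul_comm]; exact (EuclideanDomain.div_add_mod _ _).symm)
    (degree_mod_lt _ hgen.1) _ rfl
  refine ⟨dual (constD (star r) * mkDual (h • (constQ r * Q))
    (D + (D.re / (constQ r * Q).imK) • (constQ r * Q * kQ))), ?_⟩
  rw [← hprimal, mkDual_primal_dual]
  exact ⟨hsol, fun hd => hdeg hd hdom.1 hdom.2⟩
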